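/- Let $\Bbbk$ be a field containing $\mathbb R$, let $0<q\le p$ be integers, and let $\{1,\dots,p\}=J_1\cup\dots\cup J_{r+1}$ be a partition into consecutive intervals such that $J_{r+1}=\{q+1,\dots,p\}$ (empty if $q=p$) and $J_1,\dots,J_r$ are non-empty. Let $\Lambda=\Bbbk[\lambda_1,\dots,\lambda_p]$. Let $*$ be the involutive ring automorphism of $\Lambda$ that acts on $\Bbbk$ by an $\mathbb R$-linear field automorphism of square $1$ (e.g. the identity, or complex conjugation if $\Bbbk=\mathbb C$) and satisfies $\lambda_i^*=\zeta_i-\lambda_i$, where $\zeta_i\in\{0,1\}$ is constant on each $J_k$. For $1\le i\le q$ let $\sigma_i$ be the $\Bbbk$-automorphism of $\Lambda$ with $\sigma_i(\lambda_i)=\lambda_i-1$ and $\sigma_i(\lambda_j)=\lambda_j$ for $j\ne i$. Let $S\subset\Lambda\setminus\{0\}$ be a multiplicatively closed set with $\pm1\in S$ such that: $S$ is stable under $*$, under all $\sigma_i^{\pm1}$ with $i\le q$, and under the permutations of the variables that preserve each $J_k$; every non-constant divisor of an element of $S$ belongs to $S$ up to a nonzero scalar; and every irreducible divisor of an element of $S$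 is, up to a scalar, of the form $\pm\lambda_i+c$, $\pm2\lambda_i+c$ or $\pm\lambda_i\pm\lambda_j+c$ with $c\in\mathbb Z$. Put $\mathbb L=S^{-1}\Lambda$, and extend $*$ and the $\sigma_i$ to $\mathbb L$. Let $t_i$ and $\mu_{ij}$ $(1\le i,j\le q)$ be units of $\mathbb L$; put $\bar t_i=t_i^*$, and assume $$\bar t_i=\sigma_i(t_i),\qquad \mu_{ij}\mu_{ji}=1,\quad \mu_{ii}=1,\qquad \mu_{ij}^{-1}=\mu_{ij}^*,\quad \sigma_i\sigma_j(\mu_{ij})=\mu_{ij},$$ $$\sigma_i(\mu_{ij})\,\sigma_j(\mu_{ij})=\frac{\sigma_j^{-1}(\bar t_i)\,\bar t_j}{\bar t_i\,\sigma_i^{-1}(\bar t_j)},\qquad \sigma_i(\mu_{ij})\,\sigma_j^{-1}(\mu_{ij})=\frac{\sigma_j^{-1}(\bar t_i)\,\sigma_i(t_j)}{\bar t_i\,t_j}$$ for all $i,j$, moreover $\sigma_k(\mu_{ij})=\mu_{ij}$ whenever $k\notin\{i,j\}$, and $\sigma_i(t_j)\,\sigma_k^{\pm1}(t_j)=t_j\,\sigma_i\sigma_k^{\pm1}(t_j)$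 for pairwise different $i,j,k$. The RTGW algebra $\mathfrak A$ of these data is the associative unital $\Bbbk$-algebra generated by (the image of) the $\Bbbk$-algebra $\mathbb L$ and elements $X_1,Y_1,\dots,X_q,Y_q$, with the defining relations $$X_if=\sigma_i(f)X_i,\quad Y_if=\sigma_i^{-1}(f)Y_i,\quad Y_iX_i=t_i,\quad X_iY_i=\sigma_i(t_i),\quad X_iX_j=\mu_{ij}X_jX_i,\quad Y_iY_j=\mu_{ij}^*\,Y_jY_i$$ for $f\in\mathbb L$ and $1\le i,j\le q$. Then $\mathfrak A$ is a crossed product of $\mathbb L$ with $\mathbb Z^q$: setting $\deg f=0$ for $f\in\mathbb L$, $\deg X_i=e_i$ and $\deg Y_i=-e_i$ makes $\mathfrak A$ a $\mathbb Z^q$-graded algebra, the canonical map $\mathbb L\to\mathfrak A$ is injective with image the component of degree $0$, and each homogeneous component contains a unit of $\mathfrak A$. Moreover, $\mathfrak A$ is a (left and right) Ore domain. -/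

import Mathlib

open MvPolynomial

noncomputable section

/-! ### The polynomial ring `Λ = k[λ₁, …, λ_p]`, its shifts and its involution -/

/-- The shift `σᵢⁿ` of `Λ` for an integer `n`: `λᵢ ↦ λᵢ - n`, and `λⱼ ↦ λⱼ` for `j ≠ i`. -/
def polyShift {k : Type*} [Field k] {p : ℕ} (i : Fin p) (n : ℤ) :
    MvPolynomial (Fin p) k →ₐ[k] MvPolynomial (Fin p) k :=
  aeval fun j => X j - C (if j = i then (n : k) else 0)

/-- The involution `*` of `Λ`: it acts on the scalars by `κ`, and `λᵢ ↦ ζᵢ - λᵢ`. -/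
def polyStar {k : Type*} [Field k] [Algebra ℝ k] {p : ℕ} (κ : k ≃ₐ[ℝ] k) (ζ : Fin p → ℕ) :
    MvPolynomial (Fin p) k →+* MvPolynomial (Fin p) k :=
  eval₂Hom (C.comp (κ : k →+* k)) fun i => C (ζ i : k) - X i

/-- Linear polynomials of the form `±λᵢ + c`, `±2λᵢ + c` or `±λᵢ ± λⱼ + c` with `c ∈ ℤ`,
up to a factor from `k`. -/
def IsDoubleLinear {k : Type*} [Field k] {p : ℕ} (f : MvPolynomial (Fin p) k) : Prop :=
  ∃ (a : k) (c : ℤ) (ε δ : ℤˣ) (i j : Fin p),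
    f = C a * (((ε : ℤ) : MvPolynomial (Fin p) k) * X i + (c : MvPolynomial (Fin p) k)) ∨
    f = C a * (((ε : ℤ) : MvPolynomial (Fin p) k) * (2 * X i) +
      (c : MvPolynomial (Fin p) k)) ∨
    f = C a * (((ε : ℤ) : MvPolynomial (Fin p) k) * X i +
      ((δ : ℤ) : MvPolynomial (Fin p) k) * X j + (c : MvPolynomial (Fin p) k))

/-- The coefficient part of an RTGW datum of type `(p, q)`: the storey partition of the index
set, the involution of `Λ`, and the multiplicative set `S`.  Indices run through `Fin p`; the
set `{1, …, q}` is the initial segment `Fin q`, embedded by `Fin.castLE`. -/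
structure RTGWBase (k : Type*) [Field k] [Algebra ℝ k] (p q : ℕ) where
  q_pos : 0 < q
  q_le : q ≤ p
  /-- The storey partition has `r + 1` parts `J₁, …, J_{r+1}`. -/
  r : ℕ
  /-- The number of the part to which an index belongs. -/
  part : Fin p → Fin (r + 1)
  /-- The parts are consecutive intervals. -/
  part_mono : Monotone part
  /-- The last part consists of the indices behind the first `q` ones; it is empty if `q = p`. -/
  part_eq_last : ∀ i, part i = Fin.last r ↔ q ≤ (i : ℕ)
  /-- The other parts are non-empty. -/
  part_surj : ∀ m, m ≠ Fin.last r → ∃ i, part i = m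
  /-- The action of `*` on the scalars (the identity, or complex conjugation if `k = ℂ`). -/
  conj : k ≃ₐ[ℝ] k
  conj_conj : ∀ a, conj (conj a) = a
  /-- The parameters of the involution. -/
  ζ : Fin p → ℕ
  ζ_mem : ∀ i, ζ i = 0 ∨ ζ i = 1
  ζ_part : ∀ i j, part i = part j → ζ i = ζ j
  /-- The multiplicative set. -/
  S : Submonoid (MvPolynomial (Fin p) k)
  zero_notMem : (0 : MvPolynomial (Fin p) k) ∉ S
  neg_one_mem : (-1 : MvPolynomial (Fin p) k) ∈ S
  /-- `S` is saturated: non-constant divisors of its elements belong to it, up to a nonzero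
  scalar. -/
  saturated : ∀ s ∈ S, ∀ d, d ∣ s → (∀ c : k, d ≠ C c) → ∃ a : k, a ≠ 0 ∧ C a * d ∈ S
  /-- `S` is double. -/
  double : ∀ s ∈ S, ∀ d, d ∣ s → Irreducible d → IsDoubleLinear d
  /-- `S` is involuted. -/
  star_mem : ∀ s ∈ S, polyStar conj ζ s ∈ S
  /-- `S` is stable under the shift group generated by `σ₁, …, σ_q`. -/
  shift_mem : ∀ (i : Fin q) (n : ℤ), ∀ s ∈ S, polyShift (Fin.castLE q_le i) n s ∈ S
  /-- `S` is stable under the permutations of the variables that preserve the parts. -/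
  perm_mem : ∀ π : Equiv.Perm (Fin p), (∀ i, part (π i) = part i) →
    ∀ s ∈ S, rename π s ∈ S

namespace RTGWBase

variable {k : Type*} [Field k] [Algebra ℝ k] {p q : ℕ} (B : RTGWBase k p q)

/-- The ring `𝕃 = S⁻¹Λ`. -/
abbrev L : Type _ := Localization B.S

/-- The automorphism `σᵢⁿ` of `𝕃`, `i ∈ {1, …, q}`, `n ∈ ℤ`. -/
def shift (i : Fin q) (n : ℤ) : B.L →+* B.L :=
  IsLocalization.map B.L
    (polyShift (Fin.castLE B.q_le i) n : MvPolynomial (Fin p) k →ₐ[k] _).toRingHom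
    (show B.S ≤ B.S.comap _ from fun s hs => B.shift_mem i n s hs)

/-- The involution `*` of `𝕃`. -/
def star : B.L →+* B.L :=
  IsLocalization.map B.L (polyStar B.conj B.ζ)
    (show B.S ≤ B.S.comap _ from fun s hs => B.star_mem s hs)

/-- `σᵢⁿ` on the unit group of `𝕃`. -/
def ushift (i : Fin q) (n : ℤ) : B.Lˣ →* B.Lˣ := Units.map (B.shift i n : B.L →* B.L)

/-- `*` on the unit group of `𝕃`. -/
def ustar : B.Lˣ →* B.Lˣ := Units.map (B.star : B.L →* B.L)

end RTGWBase

/-- An RTGW datum of type `(p, q)`, with the consistency equations for its parameters.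
The rule `(σ(f))* = σ⁻¹(f*)` holds automatically, and the groups of permutations and of shifts
are determined by the coefficient part. -/
structure RTGWDatum (k : Type*) [Field k] [Algebra ℝ k] (p q : ℕ) extends RTGWBase k p q where
  t : Fin q → toRTGWBase.Lˣ
  μ : Fin q → Fin q → toRTGWBase.Lˣ
  star_t : ∀ i, toRTGWBase.ustar (t i) = toRTGWBase.ushift i 1 (t i)
  μ_mul : ∀ i j, μ i j * μ j i = 1
  μ_self : ∀ i, μ i i = 1
  star_μ : ∀ i j, (μ i j)⁻¹ = toRTGWBase.ustar (μ i j)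
  shift_shift_μ : ∀ i j, toRTGWBase.ushift i 1 (toRTGWBase.ushift j 1 (μ i j)) = μ i j
  shift_μ : ∀ i j l, l ≠ i → l ≠ j → toRTGWBase.ushift l 1 (μ i j) = μ i j
  /-- `σᵢ(μᵢⱼ) σⱼ(μᵢⱼ) = σⱼ⁻¹(t̄ᵢ) t̄ⱼ / (t̄ᵢ σᵢ⁻¹(t̄ⱼ))`, where `t̄ᵢ = tᵢ*`. -/
  μ_t_one : ∀ i j, toRTGWBase.ushift i 1 (μ i j) * toRTGWBase.ushift j 1 (μ i j) =
    (toRTGWBase.ushift j (-1) (toRTGWBase.ustar (t i)) * toRTGWBase.ustar (t j)) /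
      (toRTGWBase.ustar (t i) * toRTGWBase.ushift i (-1) (toRTGWBase.ustar (t j)))
  /-- `σᵢ(μᵢⱼ) σⱼ⁻¹(μᵢⱼ) = σⱼ⁻¹(t̄ᵢ) σᵢ(tⱼ) / (t̄ᵢ tⱼ)`. -/
  μ_t_two : ∀ i j, toRTGWBase.ushift i 1 (μ i j) * toRTGWBase.ushift j (-1) (μ i j) =
    (toRTGWBase.ushift j (-1) (toRTGWBase.ustar (t i)) * toRTGWBase.ushift i 1 (t j)) /
      (toRTGWBase.ustar (t i) * t j)
  /-- `σᵢ(tⱼ) σₗ^{±1}(tⱼ) = tⱼ σᵢ(σₗ^{±1}(tⱼ))` for pairwise different `i, j, l`. -/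
  t_three : ∀ i j l, i ≠ j → l ≠ i → l ≠ j → ∀ n : ℤ, n = 1 ∨ n = -1 →
    toRTGWBase.ushift i 1 (t j) * toRTGWBase.ushift l n (t j) =
      t j * toRTGWBase.ushift i 1 (toRTGWBase.ushift l n (t j))

/-- Generators of an RTGW algebra: the coefficients `f ∈ 𝕃` and the letters `Xᵢ`, `Yᵢ`. -/
inductive RTGWGen {k : Type*} [Field k] [Algebra ℝ k] {p q : ℕ} (D : RTGWDatum k p q)
  | coeff (f : D.L) : RTGWGen D
  | x (i : Fin q) : RTGWGen D
  | y (i : Fin q) : RTGWGen D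

namespace RTGWDatum

variable {k : Type*} [Field k] [Algebra ℝ k] {p q : ℕ} (D : RTGWDatum k p q)

/-- The free `k`-algebra on the generators. -/
abbrev Free : Type _ := FreeAlgebra k (RTGWGen D)

/-- A coefficient as an element of the free algebra. -/
abbrev fc (f : D.L) : D.Free := FreeAlgebra.ι k (RTGWGen.coeff f)

/-- The letter `Xᵢ` as an element of the free algebra. -/
abbrev fx (i : Fin q) : D.Free := FreeAlgebra.ι k (RTGWGen.x i)

/-- The letter `Yᵢ` as an element of the free algebra. -/
abbrev fy (i : Fin q) : D.Free := FreeAlgebra.ι k (RTGWGen.y i)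

/-- The defining relations.  The first three say that the coefficients form a homomorphic image
of the `k`-algebra `𝕃`; the last one is the image of the previous one under the rule of
involution, which permutes the other relations. -/
inductive Rel : D.Free → D.Free → Prop
  | coeff_add (f g : D.L) : Rel (D.fc (f + g)) (D.fc f + D.fc g)
  | coeff_mul (f g : D.L) : Rel (D.fc (f * g)) (D.fc f * D.fc g)
  | coeff_scalar (c : k) : Rel (D.fc (algebraMap k D.L c)) (algebraMap k D.Free c)
  | x_coeff (i : Fin q) (f : D.L) : Rel (D.fx i * D.fc f) (D.fc (D.shift i 1 f) * D.fx i)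
  | y_coeff (i : Fin q) (f : D.L) : Rel (D.fy i * D.fc f) (D.fc (D.shift i (-1) f) * D.fy i)
  | y_x (i : Fin q) : Rel (D.fy i * D.fx i) (D.fc (D.t i))
  | x_y (i : Fin q) : Rel (D.fx i * D.fy i) (D.fc (D.shift i 1 (D.t i)))
  | x_x (i j : Fin q) : Rel (D.fx i * D.fx j) (D.fc (D.μ i j) * D.fx j * D.fx i)
  | y_y (i j : Fin q) : Rel (D.fy i * D.fy j) (D.fc (D.star (D.μ i j)) * D.fy j * D.fy i)

/-- The RTGW algebra `𝔄` of the datum. -/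
abbrev Alg : Type _ := RingQuot D.Rel

/-- The image of a generator in `𝔄`. -/
def gen (z : RTGWGen D) : D.Alg := RingQuot.mkAlgHom k D.Rel (FreeAlgebra.ι k z)

/-- The structure homomorphism `𝕃 → 𝔄`. -/
def rho : D.L →ₐ[k] D.Alg where
  toFun f := D.gen (RTGWGen.coeff f)
  map_one' := by
    have h := RingQuot.mkAlgHom_rel k (Rel.coeff_scalar (D := D) 1)
    simpa only [map_one, gen] using h
  map_mul' f g := by
    have h := RingQuot.mkAlgHom_rel k (Rel.coeff_mul (D := D) f g)
    simpa only [map_mul, gen] using h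
  map_zero' := by
    have h := RingQuot.mkAlgHom_rel k (Rel.coeff_scalar (D := D) 0)
    simpa only [map_zero, gen] using h
  map_add' f g := by
    have h := RingQuot.mkAlgHom_rel k (Rel.coeff_add (D := D) f g)
    simpa only [map_add, gen] using h
  commutes' c := by
    have h := RingQuot.mkAlgHom_rel k (Rel.coeff_scalar (D := D) c)
    simpa only [AlgHom.commutes, gen] using h

/-- The degree of a generator in `ℤ^q`: `0` for coefficients, `eᵢ` for `Xᵢ`, `-eᵢ` for `Yᵢ`. -/
def genDeg : RTGWGen D → (Fin q → ℤ)
  | .coeff _ => 0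
  | .x i => Pi.single i 1
  | .y i => -Pi.single i 1

/-- The component of degree `g` of `𝔄`: the span of the words of degree `g` in the generators. -/
def homog (g : Fin q → ℤ) : Submodule k D.Alg :=
  Submodule.span k {a | ∃ w : List (RTGWGen D), (w.map D.genDeg).sum = g ∧
    a = (w.map D.gen).prod}

end RTGWDatum

/-- The `k`-algebra `A`, with the family `𝒜` of submodules indexed by the group `G` (written
additively) and the homomorphism `ρ : R → A`, is a crossed product of `R` and `G`: `𝒜` is a
`G`-grading of `A`, `ρ` is an isomorphism of `R` onto the component of degree `0`, and each
component contains a unit of `A`. -/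
structure IsCrossedProduct {k R A G : Type*} [CommRing k] [Ring R] [Ring A] [Algebra k R]
    [Algebra k A] [AddGroup G] [DecidableEq G] (ρ : R →ₐ[k] A) (𝒜 : G → Submodule k A) :
    Prop where
  gradedMonoid : SetLike.GradedMonoid 𝒜
  isInternal : DirectSum.IsInternal 𝒜
  injective : Function.Injective ρ
  mem_zero_iff : ∀ a, a ∈ 𝒜 0 ↔ ∃ f, ρ f = a
  exists_unit : ∀ g, ∃ u : Aˣ, (u : A) ∈ 𝒜 g

/-- A (left and right) Ore domain. -/
structure IsOreDomain (A : Type*) [Ring A] : Prop where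
  isDomain : IsDomain A
  left_ore : ∀ a b : A, a ≠ 0 → b ≠ 0 → ∃ c d : A, c * a = d * b ∧ c * a ≠ 0
  right_ore : ∀ a b : A, a ≠ 0 → b ≠ 0 → ∃ c d : A, a * c = b * d ∧ a * c ≠ 0

end

/-! Since the `tᵢ` are units, each `Xᵢ` is a unit of `𝔄` and `Yᵢ = tᵢ Xᵢ⁻¹`. So every word is a
coefficient times a monomial in the `Xᵢ^{±1}`, and up to coefficients these monomials commute. Hence
a word of degree `0` is a coefficient, and every component is a coefficient multiple of one unit.

That nothing collapses is seen on a representation. On functions `ℤ^q → 𝕃`, let `Xᵢ` translate by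
`eᵢ`, apply `σᵢ` and multiply by the factor that moving `Xᵢ` past `X₁, …, Xᵢ₋₁` produces. The
relations for the `Xᵢ` reduce to `cocycle_comm`, and those for the `Yᵢ` then follow from the
equations linking `μ` and `t` (`unit_y_y`). Coefficients act faithfully and degree `g` translates
supports by `g`, which gives injectivity of `rho` and directness of the sum (`eq_zero_of_proj`).

Given the crossed product, absence of zero divisors comes from unique sums in `ℤ^q`. The Ore
condition is a count: for a large box `B`, the `2|B|` elements `u_g a`, `u_g b` with `g ∈ B` lie in
an `𝕃`-span of fewer than `2|B|` monomials, so a linear relation gives a common multiple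
(`exists_card_add_lt`, `exists_mul_eq_mul`). -/

lemma polyShift_polyShift {k : Type*} [Field k] {p : ℕ} (i : Fin p) (m n : ℤ)
    (f : MvPolynomial (Fin p) k) : polyShift i m (polyShift i n f) = polyShift i (m + n) f := by
  have : (polyShift i m).comp (polyShift i n) = polyShift (k := k) i (m + n) := by
    refine MvPolynomial.algHom_ext fun j => ?_
    by_cases h : j = i <;> simp [polyShift, h]
    ring
  exact DFunLike.congr_fun this f

lemma polyShift_zero {k : Type*} [Field k] {p : ℕ} (i : Fin p)
    (f : MvPolynomial (Fin p) k) : polyShift i 0 f = f := by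
  have : polyShift i 0 = AlgHom.id k (MvPolynomial (Fin p) k) := by
    refine MvPolynomial.algHom_ext fun j => ?_
    simp [polyShift]
  exact DFunLike.congr_fun this f

lemma polyShift_comm {k : Type*} [Field k] {p : ℕ} (i j : Fin p) (m n : ℤ)
    (f : MvPolynomial (Fin p) k) :
    polyShift i m (polyShift j n f) = polyShift j n (polyShift i m f) := by
  have : (polyShift i m).comp (polyShift j n) =
      (polyShift (k := k) j n).comp (polyShift i m) := by
    refine MvPolynomial.algHom_ext fun l => ?_
    by_cases h : l = i <;> by_cases h' : l = j <;> simp [polyShift, h, h']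
    all_goals split_ifs <;> ring
  exact DFunLike.congr_fun this f

namespace RTGWBase

variable {k : Type*} [Field k] [Algebra ℝ k] {p q : ℕ} (B : RTGWBase k p q)

instance : IsDomain B.L :=
  IsLocalization.isDomain_localization
    (le_nonZeroDivisors_of_noZeroDivisors B.zero_notMem)

@[simp]
lemma shift_algebraMap (i : Fin q) (n : ℤ) (f : MvPolynomial (Fin p) k) :
    B.shift i n (algebraMap _ B.L f) = algebraMap _ B.L (polyShift (Fin.castLE B.q_le i) n f) :=
  IsLocalization.map_eq _ f

lemma shift_scalar (i : Fin q) (n : ℤ) (c : k) :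
    B.shift i n (algebraMap k B.L c) = algebraMap k B.L c := by
  rw [IsScalarTower.algebraMap_apply k (MvPolynomial (Fin p) k) B.L, shift_algebraMap,
    AlgHom.commutes]

lemma shift_shift (i : Fin q) (m n : ℤ) (f : B.L) :
    B.shift i m (B.shift i n f) = B.shift i (m + n) f := by
  have : (B.shift i m).comp (B.shift i n) = B.shift i (m + n) := by
    refine IsLocalization.ringHom_ext B.S (RingHom.ext fun f => ?_)
    simp [polyShift_polyShift]
  exact DFunLike.congr_fun this f

lemma shift_zero (i : Fin q) (f : B.L) : B.shift i 0 f = f := by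
  have : B.shift i 0 = RingHom.id _ := by
    refine IsLocalization.ringHom_ext B.S (RingHom.ext fun f => ?_)
    simp [polyShift_zero]
  exact DFunLike.congr_fun this f

lemma shift_comm (i j : Fin q) (m n : ℤ) (f : B.L) :
    B.shift i m (B.shift j n f) = B.shift j n (B.shift i m f) := by
  have : (B.shift i m).comp (B.shift j n) = (B.shift j n).comp (B.shift i m) := by
    refine IsLocalization.ringHom_ext B.S (RingHom.ext fun f => ?_)
    simp [polyShift_comm _ (Fin.castLE B.q_le j)]
  exact DFunLike.congr_fun this f

/-- The shift `σᵢ` as an automorphism of `𝕃`. -/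
noncomputable def shiftEquiv (i : Fin q) : B.L ≃+* B.L :=
  RingEquiv.ofRingHom (B.shift i 1) (B.shift i (-1))
    (RingHom.ext fun f => by simp [shift_shift, shift_zero])
    (RingHom.ext fun f => by simp [shift_shift, shift_zero])

/-- The shift `σᵢ` as an automorphism of the unit group of `𝕃`. -/
noncomputable def ushiftEquiv (i : Fin q) : MulAut B.Lˣ := Units.mapEquiv (B.shiftEquiv i).toMulEquiv

lemma ushiftEquiv_apply_val (i : Fin q) (u : B.Lˣ) :
    ((B.ushiftEquiv i u : B.Lˣ) : B.L) = B.shift i 1 u := rfl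

lemma ushiftEquiv_comm (i j : Fin q) :
    B.ushiftEquiv i * B.ushiftEquiv j = B.ushiftEquiv j * B.ushiftEquiv i :=
  MulEquiv.ext fun u => Units.ext (B.shift_comm i j 1 1 u)

end RTGWBase

/-! ### Twisted powers and the cocycle of the reordering -/

/-- The twisted power `u σ(u) ⋯ σⁿ⁻¹(u)` for an automorphism `σ` of a group, extended to integers
`n` by means of the semidirect product. -/
noncomputable def twistedPow {U : Type*} [Group U] (σ : MulAut U) (u : U) (n : ℤ) : U :=
  ((⟨u, σ⟩ : U ⋊[MonoidHom.id (MulAut U)] MulAut U) ^ n).left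

lemma twistedPow_one_add {U : Type*} [Group U] (σ : MulAut U) (u : U) (n : ℤ) :
    twistedPow σ u (1 + n) = u * σ (twistedPow σ u n) := by
  simp [twistedPow, zpow_add]

/-- In the semidirect product `(1, τ)` commutes with `(u, σ)`, hence with all its powers; compare
left components. -/
lemma map_twistedPow {U : Type*} [Group U] {σ τ : MulAut U} {u : U} (h : τ * σ = σ * τ)
    (hu : τ u = u) (n : ℤ) : τ (twistedPow σ u n) = twistedPow σ u n := by
  have hc : Commute (⟨1, τ⟩ : U ⋊[MonoidHom.id (MulAut U)] MulAut U) ⟨u, σ⟩ := by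
    ext <;> simp [hu, h]
  simpa [twistedPow] using congrArg SemidirectProduct.left (hc.zpow_right n).eq

namespace RTGWDatum

variable {k : Type*} [Field k] [Algebra ℝ k] {p q : ℕ} (D : RTGWDatum k p q)

/-- The factor that arises when `Xᵢ` is moved to its place in `X₁^{g₁} ⋯ X_q^{g_q}`. -/
noncomputable def cocycle (i : Fin q) (g : Fin q → ℤ) : D.Lˣ :=
  ∏ j ∈ Finset.Iio i, twistedPow (D.ushiftEquiv j) (D.μ i j) (g j)

lemma cocycle_single_add_of_le {i j : Fin q} (h : i ≤ j) (g : Fin q → ℤ) :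
    D.cocycle i (Pi.single j 1 + g) = D.cocycle i g := by
  refine Finset.prod_congr rfl fun l hl => ?_
  have : l ≠ j := ((Finset.mem_Iio.1 hl).trans_le h).ne
  simp [this]

/-- Only `μᵢₗ` and `σₗ` with `l < i` enter, and `σⱼ` fixes these `μᵢₗ`. -/
lemma ushift_cocycle {i j : Fin q} (h : i < j) (g : Fin q → ℤ) :
    D.ushiftEquiv j (D.cocycle i g) = D.cocycle i g := by
  rw [cocycle, map_prod]
  refine Finset.prod_congr rfl fun l hl => ?_
  exact map_twistedPow (D.ushiftEquiv_comm _ _)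
    (D.shift_μ _ _ _ h.ne' ((Finset.mem_Iio.1 hl).trans h).ne') _

/-- One more `Xⱼ` prolongs the twisted power with index `j` by one step; the other factors are fixed
by `σⱼ`. -/
lemma cocycle_single_add {i j : Fin q} (h : j < i) (g : Fin q → ℤ) :
    D.cocycle i (Pi.single j 1 + g) = D.μ i j * D.ushiftEquiv j (D.cocycle i g) := by
  have hj : j ∈ Finset.Iio i := Finset.mem_Iio.2 h
  rw [cocycle, cocycle, ← Finset.mul_prod_erase _ _ hj, ← Finset.mul_prod_erase _ _ hj, map_mul,
    map_prod, ← mul_assoc, Pi.add_apply, Pi.single_eq_same, twistedPow_one_add]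
  congr 1
  refine Finset.prod_congr rfl fun l hl => ?_
  obtain ⟨hlj, hl⟩ := Finset.mem_erase.1 hl
  rw [map_twistedPow (D.ushiftEquiv_comm _ _) (D.shift_μ _ _ _ h.ne hlj.symm)]
  simp [hlj]

/-- The consistency of the factors for `XᵢXⱼ = μᵢⱼ XⱼXᵢ`. -/
lemma cocycle_comm (i j : Fin q) (g : Fin q → ℤ) :
    D.ushiftEquiv i (D.cocycle j g) * D.cocycle i (Pi.single j 1 + g) =
      D.μ i j * (D.ushiftEquiv j (D.cocycle i g) * D.cocycle j (Pi.single i 1 + g)) := by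
  rcases lt_trichotomy i j with h | rfl | h
  · rw [D.cocycle_single_add_of_le h.le, D.cocycle_single_add h, D.ushift_cocycle h,
      mul_left_comm (D.cocycle i g), ← mul_assoc (D.μ i j), D.μ_mul, one_mul, mul_comm]
  · rw [D.μ_self, one_mul]
  · rw [D.cocycle_single_add_of_le h.le, D.cocycle_single_add h, D.ushift_cocycle h]
    exact mul_rotate' (D.cocycle j g) _ _

/-! ### The model: invertible operators satisfying the relations of the `Xᵢ` -/

/-- The module on which the algebra is represented. -/
abbrev Model : Type _ := (Fin q → ℤ) → D.L

/-- The action of a coefficient on the model. -/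
noncomputable def modelCoeff : D.L →ₐ[k] Module.End k D.Model := Algebra.lsmul k k D.Model

/-- The action of `Xᵢ` on the model. -/
noncomputable def modelX (i : Fin q) : Module.End k D.Model where
  toFun m g := D.shift i 1 (m (-Pi.single i 1 + g)) * D.cocycle i g
  map_add' m m' := by ext g; simp [add_mul]
  map_smul' c m := by ext g; simp [Algebra.smul_def, D.shift_scalar, mul_assoc]

/-- The action of the inverse of `Xᵢ` on the model. -/
noncomputable def modelXInv (i : Fin q) : Module.End k D.Model where
  toFun m g := D.shift i (-1) (m (Pi.single i 1 + g) * ↑(D.cocycle i g)⁻¹)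
  map_add' m m' := by ext g; simp [add_mul]
  map_smul' c m := by ext g; simp [Algebra.smul_def, D.shift_scalar, mul_assoc]

lemma modelCoeff_apply (f : D.L) (m : D.Model) (g : Fin q → ℤ) :
    D.modelCoeff f m g = f * m g := rfl

lemma modelX_apply (i : Fin q) (m : D.Model) (g : Fin q → ℤ) :
    D.modelX i m g = D.shift i 1 (m (-Pi.single i 1 + g)) * D.cocycle i g := rfl

lemma modelXInv_apply (i : Fin q) (m : D.Model) (g : Fin q → ℤ) :
    D.modelXInv i m g = D.shift i (-1) (m (Pi.single i 1 + g) * ↑(D.cocycle i g)⁻¹) := rfl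

/-- The action of `Xᵢ` on the model as an invertible operator. -/
noncomputable def modelUnit (i : Fin q) : (Module.End k D.Model)ˣ where
  val := D.modelX i
  inv := D.modelXInv i
  val_inv := by
    ext m g
    have h := D.cocycle_single_add_of_le (le_refl i) (-Pi.single i 1 + g)
    rw [add_neg_cancel_left] at h
    simp [modelX_apply, modelXInv_apply, D.shift_shift, D.shift_zero, h]
  inv_val := by
    ext m g
    simp [modelX_apply, modelXInv_apply, D.shift_shift, D.shift_zero,
      D.cocycle_single_add_of_le (le_refl i)]

lemma modelX_coeff (i : Fin q) (f : D.L) :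
    ↑(D.modelUnit i) * D.modelCoeff f = D.modelCoeff (D.shift i 1 f) * ↑(D.modelUnit i) := by
  ext m g
  simp [modelUnit, modelX_apply, modelCoeff_apply, mul_assoc]

lemma modelX_modelX (i j : Fin q) :
    (D.modelUnit i : Module.End k D.Model) * D.modelUnit j =
      D.modelCoeff (D.μ i j) * D.modelUnit j * D.modelUnit i := by
  ext m g
  -- At this point of the lattice both sides involve only the value of `m` at the new `g`, and the
  -- factors are those of `cocycle_comm`.
  obtain ⟨g, rfl⟩ : ∃ g', g = Pi.single i 1 + (Pi.single j 1 + g') :=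
    ⟨-Pi.single j 1 + (-Pi.single i 1 + g), by simp⟩
  have h := congrArg Units.val (D.cocycle_comm i j g)
  simp only [Units.val_mul, RTGWBase.ushiftEquiv_apply_val] at h
  have hj := D.cocycle_single_add_of_le (le_refl j)
  have hi := D.cocycle_single_add_of_le (le_refl i)
  have hg : (Pi.single i 1 + (Pi.single j 1 + g) : Fin q → ℤ) =
    Pi.single j 1 + (Pi.single i 1 + g) := add_left_comm _ _ _
  have hl : ((D.modelUnit i : Module.End k D.Model) * D.modelUnit j) m
      (Pi.single i 1 + (Pi.single j 1 + g)) =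
      D.shift i 1 (D.shift j 1 (m g)) *
        (D.shift i 1 (D.cocycle j g) * D.cocycle i (Pi.single j 1 + g)) := by
    simp [modelUnit, modelX_apply, hi, hj, mul_assoc]
  have hr : (D.modelCoeff (D.μ i j) * D.modelUnit j * D.modelUnit i : Module.End k D.Model) m
      (Pi.single i 1 + (Pi.single j 1 + g)) =
      D.shift j 1 (D.shift i 1 (m g)) *
        (D.μ i j * (D.shift j 1 (D.cocycle i g) * D.cocycle j (Pi.single i 1 + g))) := by
    rw [hg]
    simp [modelUnit, modelX_apply, modelCoeff_apply, hi, hj, mul_assoc, mul_left_comm]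
  exact hl.trans (congrArg₂ (· * ·) (D.shift_comm i j _ _ _) h) |>.trans hr.symm

/-! ### Consequences for inverses of the `Xᵢ` and for `Yᵢ = tᵢ Xᵢ⁻¹` -/

section Units

variable {R : Type*} [Ring R] [Algebra k R] {ρ : D.L →ₐ[k] R} {x : Fin q → Rˣ}

lemma unit_inv_coeff (hx : ∀ i f, x i * ρ f = ρ (D.shift i 1 f) * x i) (i : Fin q) (f : D.L) :
    ↑(x i)⁻¹ * ρ f = ρ (D.shift i (-1) f) * ↑(x i)⁻¹ := by
  rw [Units.inv_mul_eq_iff_eq_mul, ← mul_assoc, hx, mul_assoc, Units.mul_inv, mul_one,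
    D.shift_shift, add_neg_cancel, D.shift_zero]

/-- The commutator of `xᵢ` and `xⱼ` is `μᵢⱼ`, and conjugation by `xᵢxⱼ` fixes it, because `σᵢσⱼ`
fixes `μᵢⱼ`. -/
lemma unit_inv_mul_inv (hx : ∀ i f, x i * ρ f = ρ (D.shift i 1 f) * x i)
    (hxx : ∀ i j, (x i : R) * x j = ρ (D.μ i j) * x j * x i) (i j : Fin q) :
    (↑(x i)⁻¹ * ↑(x j)⁻¹ : R) = ρ (D.μ i j) * ↑(x j)⁻¹ * ↑(x i)⁻¹ := by
  have h : D.shift i 1 (D.shift j 1 (D.μ i j)) = D.μ i j :=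
    congrArg (Units.val (α := D.L)) (D.shift_shift_μ i j)
  apply (x j).isUnit.mul_left_cancel
  apply (x i).isUnit.mul_left_cancel
  calc (x i * (x j * (↑(x i)⁻¹ * ↑(x j)⁻¹)) : R)
      = (x i * x j) * ↑(x i)⁻¹ * ↑(x j)⁻¹ := by simp only [mul_assoc]
    _ = ρ (D.μ i j) := by rw [hxx]; simp
    _ = ρ (D.μ i j) * (x i * (x j * (↑(x j)⁻¹ * ↑(x i)⁻¹))) := by simp
    _ = x i * (x j * ρ (D.μ i j)) * (↑(x j)⁻¹ * ↑(x i)⁻¹) := by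
      rw [hx j, ← mul_assoc (x i : R) (ρ _), hx, h]; simp only [mul_assoc]
    _ = x i * (x j * (ρ (D.μ i j) * ↑(x j)⁻¹ * ↑(x i)⁻¹)) := by simp only [mul_assoc]

/-- The square of `μᵢⱼ` in terms of the `tᵢ`. -/
lemma μ_mul_μ (i j : Fin q) :
    (D.μ i j * D.μ i j * (D.t i * D.shift i (-1) (D.t j)) : D.L) =
      D.shift j (-1) (D.t i) * D.t j := by
  have h := D.μ_t_two i j
  rw [D.star_t, eq_div_iff_mul_eq'] at h
  -- Applying `σᵢ⁻¹` turns the left side into `μᵢⱼ · σᵢ⁻¹σⱼ⁻¹(μᵢⱼ)`, which is a square since `σᵢσⱼ`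
  -- fixes `μᵢⱼ`.
  have h := congrArg (D.shift i (-1)) (congrArg (Units.val (α := D.L)) h)
  have hμ : D.shift i 1 (D.shift j 1 (D.μ i j)) = D.μ i j :=
    congrArg (Units.val (α := D.L)) (D.shift_shift_μ i j)
  simp only [Units.val_mul, map_mul, RTGWBase.ushift, Units.coe_map, MonoidHom.coe_coe,
    D.shift_comm j i (-1)] at h
  rw [← hμ, D.shift_comm j i (-1)] at h
  simp only [D.shift_shift, D.shift_zero, neg_add_cancel, hμ] at h
  exact h

lemma unit_y_y (hx : ∀ i f, x i * ρ f = ρ (D.shift i 1 f) * x i)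
    (hxx : ∀ i j, (x i : R) * x j = ρ (D.μ i j) * x j * x i) (i j : Fin q) :
    (ρ (D.t i) * ↑(x i)⁻¹) * (ρ (D.t j) * ↑(x j)⁻¹) =
      ρ (D.star (D.μ i j)) * (ρ (D.t j) * ↑(x j)⁻¹) * (ρ (D.t i) * ↑(x i)⁻¹) := by
  have hs : D.μ i j * D.star (D.μ i j) = 1 := by
    have h := congrArg (Units.val (α := D.L)) (D.star_μ i j)
    exact (congrArg (_ * ·) h.symm).trans (Units.mul_inv _)
  -- This is `μ_mul_μ` divided by `μᵢⱼ`, whose inverse is `μᵢⱼ*`.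
  have h1 : D.t i * D.shift i (-1) (D.t j) * D.μ i j =
      D.star (D.μ i j) * D.t j * D.shift j (-1) (D.t i) := by
    linear_combination D.star (D.μ i j) * D.μ_mul_μ i j -
      D.μ i j * D.t i * D.shift i (-1) (D.t j) * hs
  calc _ = ρ (D.t i) * (↑(x i)⁻¹ * ρ (D.t j)) * ↑(x j)⁻¹ := by simp only [mul_assoc]
    _ = ρ (D.t i * D.shift i (-1) (D.t j)) * (↑(x i)⁻¹ * ↑(x j)⁻¹) := by
      rw [D.unit_inv_coeff hx]; simp only [map_mul, mul_assoc]
    _ = ρ (D.t i * D.shift i (-1) (D.t j) * D.μ i j) * ↑(x j)⁻¹ * ↑(x i)⁻¹ := by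
      rw [D.unit_inv_mul_inv hx hxx, map_mul ρ _ (D.μ i j : D.L)]; simp only [mul_assoc]
    _ = ρ (D.star (D.μ i j)) * ρ (D.t j) * (ρ (D.shift j (-1) (D.t i)) * ↑(x j)⁻¹) *
        ↑(x i)⁻¹ := by
      rw [h1]; simp only [map_mul, mul_assoc]
    _ = _ := by rw [← D.unit_inv_coeff hx]; simp only [mul_assoc]

end Units

/-! ### The representation of `𝔄` and the injectivity of `rho` -/

/-- The action of a generator on the model. -/
noncomputable def modelGen : RTGWGen D → Module.End k D.Model
  | .coeff f => D.modelCoeff f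
  | .x i => D.modelUnit i
  | .y i => D.modelCoeff (D.t i) * ↑(D.modelUnit i)⁻¹

lemma modelGen_rel {a b : D.Free} (h : D.Rel a b) :
    FreeAlgebra.lift k D.modelGen a = FreeAlgebra.lift k D.modelGen b := by
  have hX := D.modelX_coeff
  have hY (i : Fin q) (f : D.L) : (↑(D.modelUnit i)⁻¹ * D.modelCoeff f : Module.End k D.Model) =
      D.modelCoeff (D.shift i (-1) f) * ↑(D.modelUnit i)⁻¹ :=
    D.unit_inv_coeff (R := Module.End k D.Model) hX i f
  induction h with
  | coeff_add f g => simp [modelGen]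
  | coeff_mul f g => simp [modelGen]
  | coeff_scalar c => simp [modelGen]
  | x_coeff i f => simpa [modelGen] using hX i f
  | y_coeff i f =>
    simp only [map_mul, FreeAlgebra.lift_ι_apply, modelGen]
    rw [mul_assoc, ← mul_assoc (D.modelCoeff (D.shift i (-1) f)), ← map_mul,
      mul_comm (D.shift i (-1) f), map_mul, mul_assoc]
    exact congrArg _ (hY i f)
  | y_x i => simp [modelGen, mul_assoc]
  | x_y i =>
    simp only [map_mul, FreeAlgebra.lift_ι_apply, modelGen]
    rw [← mul_assoc, hX, mul_assoc, Units.mul_inv, mul_one]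
  | x_x i j => simpa [modelGen] using D.modelX_modelX i j
  | y_y i j =>
    simp only [map_mul, FreeAlgebra.lift_ι_apply, modelGen]
    exact D.unit_y_y (R := Module.End k D.Model) hX D.modelX_modelX i j

/-- The representation of `𝔄` on the model. -/
noncomputable def toModel : D.Alg →ₐ[k] Module.End k D.Model :=
  RingQuot.liftAlgHom k ⟨FreeAlgebra.lift k D.modelGen, fun _ _ h => D.modelGen_rel h⟩

lemma toModel_gen (z : RTGWGen D) : D.toModel (D.gen z) = D.modelGen z := by
  simp [toModel, gen]

lemma toModel_rho (f : D.L) : D.toModel (D.rho f) = D.modelCoeff f := D.toModel_gen (.coeff f)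

lemma rho_injective : Function.Injective D.rho := by
  intro f g h
  have h := congrFun (congrArg (D.toModel · 1) h) 0
  simpa [toModel_rho, modelCoeff_apply] using h

lemma gen_x_mul_rho (i : Fin q) (f : D.L) :
    D.gen (.x i) * D.rho f = D.rho (D.shift i 1 f) * D.gen (.x i) := by
  have h := RingQuot.mkAlgHom_rel k (Rel.x_coeff (D := D) i f)
  simp only [map_mul] at h
  exact h

lemma gen_y_mul_gen_x (i : Fin q) : D.gen (.y i) * D.gen (.x i) = D.rho (D.t i) := by
  have h := RingQuot.mkAlgHom_rel k (Rel.y_x (D := D) i)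
  simp only [map_mul] at h
  exact h

lemma gen_x_mul_gen_y (i : Fin q) :
    D.gen (.x i) * D.gen (.y i) = D.rho (D.shift i 1 (D.t i)) := by
  have h := RingQuot.mkAlgHom_rel k (Rel.x_y (D := D) i)
  simp only [map_mul] at h
  exact h

lemma gen_x_mul_gen_x (i j : Fin q) :
    D.gen (.x i) * D.gen (.x j) = D.rho (D.μ i j) * D.gen (.x j) * D.gen (.x i) := by
  have h := RingQuot.mkAlgHom_rel k (Rel.x_x (D := D) i j)
  simp only [map_mul] at h
  exact h

/-- The letter `Xᵢ` as a unit of `𝔄`. -/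
noncomputable def xUnit (i : Fin q) : D.Algˣ where
  val := D.gen (.x i)
  inv := D.rho ↑(D.t i)⁻¹ * D.gen (.y i)
  val_inv := by
    rw [← mul_assoc, gen_x_mul_rho, mul_assoc, gen_x_mul_gen_y, ← map_mul, ← map_mul,
      Units.inv_mul, map_one, map_one]
  inv_val := by rw [mul_assoc, gen_y_mul_gen_x, ← map_mul, Units.inv_mul, map_one]

lemma gen_y_eq (i : Fin q) : D.gen (.y i) = D.rho (D.t i) * ↑(D.xUnit i)⁻¹ := by
  change _ = D.rho (D.t i) * (D.rho ↑(D.t i)⁻¹ * D.gen (.y i))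
  rw [← mul_assoc, ← map_mul, Units.mul_inv, map_one, one_mul]

lemma xUnit_inv_mul_rho (i : Fin q) (f : D.L) :
    ↑(D.xUnit i)⁻¹ * D.rho f = D.rho (D.shift i (-1) f) * ↑(D.xUnit i)⁻¹ :=
  D.unit_inv_coeff D.gen_x_mul_rho i f

/-! ### Monomials modulo coefficients, and the component of degree `0` -/

/-- The units of `𝔄` that come from coefficients. -/
noncomputable abbrev coeffUnits : Subgroup D.Algˣ := (Units.map (D.rho : D.L →* D.Alg)).range

/-- The normalizer of the group of units that come from coefficients. -/
noncomputable abbrev coeffNormalizer : Subgroup D.Algˣ :=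
  Subgroup.normalizer (D.coeffUnits : Set D.Algˣ)

lemma xUnit_mem_normalizer (i : Fin q) : D.xUnit i ∈ D.coeffNormalizer := by
  refine Subgroup.mem_normalizer_iff.2 fun h => ⟨?_, ?_⟩
  · rintro ⟨f, rfl⟩
    refine ⟨D.ushift i 1 f, Units.ext ?_⟩
    rw [Units.val_mul, Units.eq_mul_inv_iff_mul_eq]
    exact (D.gen_x_mul_rho i f).symm
  · rintro ⟨f, hf⟩
    refine ⟨D.ushift i (-1) f, Units.ext ?_⟩
    have h' : h = (D.xUnit i)⁻¹ * Units.map (D.rho : D.L →* D.Alg) f * D.xUnit i := by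
      rw [hf]; group
    rw [h', Units.val_mul, ← Units.mul_inv_eq_iff_eq_mul]
    exact (D.xUnit_inv_mul_rho i f).symm

/-- The classes of the `Xᵢ` modulo the coefficients. -/
noncomputable def xClass (i : Fin q) :
    D.coeffNormalizer ⧸ D.coeffUnits.subgroupOf D.coeffNormalizer :=
  QuotientGroup.mk ⟨D.xUnit i, D.xUnit_mem_normalizer i⟩

/-- The commutator of `Xᵢ` and `Xⱼ` is the coefficient `μᵢⱼ`. Passing to the quotient makes the
degree of a monomial determine its class, with no normal form to choose. -/
lemma xClass_comm (i j : Fin q) : Commute (D.xClass i) (D.xClass j) := by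
  refine QuotientGroup.eq_iff_div_mem.2 (Subgroup.mem_subgroupOf.2 ⟨D.μ i j, ?_⟩)
  refine eq_div_of_mul_eq' (Units.ext ?_)
  exact (mul_assoc _ _ _).symm.trans (D.gen_x_mul_gen_x i j).symm

lemma pairwise_commute_xClass : Pairwise fun i j => ∀ m n : Multiplicative ℤ,
    Commute (zpowersHom _ (D.xClass i) m) (zpowersHom _ (D.xClass j) n) := fun i j _ m n => by
  simpa only [zpowersHom_apply] using ((D.xClass_comm i j).zpow_left _).zpow_right _

/-- The class of the monomials of a given degree modulo the coefficients. -/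
noncomputable def degClass : (Fin q → Multiplicative ℤ) →*
    D.coeffNormalizer ⧸ D.coeffUnits.subgroupOf D.coeffNormalizer :=
  MonoidHom.noncommPiCoprod (fun i => zpowersHom _ (D.xClass i)) D.pairwise_commute_xClass

/-- The units of `𝔄` that are monomials of a given degree up to a coefficient. -/
def IsMonomial (g : Fin q → ℤ) (n : D.Algˣ) : Prop :=
  ∃ h : n ∈ D.coeffNormalizer, QuotientGroup.mk ⟨n, h⟩ =
    D.degClass fun i => Multiplicative.ofAdd (g i)

lemma isMonomial_one : D.IsMonomial 0 1 :=
  ⟨one_mem _, (map_one D.degClass).symm⟩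

lemma IsMonomial.mem_range {n : D.Algˣ} (h : D.IsMonomial 0 n) : ∃ f, D.rho f = n := by
  obtain ⟨h, h'⟩ := h
  have h' := (QuotientGroup.eq_one_iff _).1 (h'.trans (map_one D.degClass))
  obtain ⟨f, hf⟩ := Subgroup.mem_subgroupOf.1 h'
  exact ⟨f, congrArg Units.val hf⟩

lemma isMonomial_xUnit (i : Fin q) : D.IsMonomial (Pi.single i 1) (D.xUnit i) := by
  refine ⟨D.xUnit_mem_normalizer i, ?_⟩
  have : (fun j => Multiplicative.ofAdd ((Pi.single i 1 : Fin q → ℤ) j)) =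
      Pi.mulSingle i (Multiplicative.ofAdd (1 : ℤ)) := by
    ext j
    by_cases h : j = i
    · subst h; simp
    · simp [h]
  rw [this, degClass, MonoidHom.noncommPiCoprod_mulSingle]
  simp [xClass]

lemma IsMonomial.mul {g g' : Fin q → ℤ} {n n' : D.Algˣ} (h : D.IsMonomial g n)
    (h' : D.IsMonomial g' n') : D.IsMonomial (g + g') (n * n') := by
  obtain ⟨h, hn⟩ := h
  obtain ⟨h', hn'⟩ := h'
  refine ⟨mul_mem h h', ?_⟩
  exact (congrArg₂ (· * ·) hn hn').trans (map_mul D.degClass _ _).symm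

lemma IsMonomial.inv {g : Fin q → ℤ} {n : D.Algˣ} (h : D.IsMonomial g n) :
    D.IsMonomial (-g) n⁻¹ := by
  obtain ⟨h, hn⟩ := h
  refine ⟨inv_mem h, ?_⟩
  exact (congrArg (·⁻¹) hn).trans (map_inv D.degClass _).symm

/-- Replace each `Yᵢ` by `tᵢ Xᵢ⁻¹` and push all coefficients to the left. -/
lemma exists_eq_rho_mul (w : List (RTGWGen D)) :
    ∃ f n, D.IsMonomial (w.map D.genDeg).sum n ∧ (w.map D.gen).prod = D.rho f * n := by
  induction w with
  | nil => exact ⟨1, 1, D.isMonomial_one, by simp⟩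
  | cons z w ih =>
    obtain ⟨f, n, hn, hw⟩ := ih
    simp only [List.map_cons, List.sum_cons, List.prod_cons, hw]
    cases z with
    | coeff f' =>
      refine ⟨f' * f, n, by simpa [genDeg] using hn, ?_⟩
      rw [map_mul, mul_assoc]; rfl
    | x i =>
      refine ⟨D.shift i 1 f, D.xUnit i * n, (D.isMonomial_xUnit i).mul D hn, ?_⟩
      rw [← mul_assoc, gen_x_mul_rho, mul_assoc]; rfl
    | y i =>
      refine ⟨D.t i * D.shift i (-1) f, (D.xUnit i)⁻¹ * n,
        (D.isMonomial_xUnit i).inv.mul D hn, ?_⟩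
      rw [gen_y_eq, mul_assoc, ← mul_assoc _ (D.rho f), xUnit_inv_mul_rho]
      simp only [map_mul, Units.val_mul, mul_assoc]

lemma mem_homog_zero_iff (a : D.Alg) : a ∈ D.homog 0 ↔ ∃ f, D.rho f = a := by
  constructor
  · intro h
    suffices D.homog 0 ≤ LinearMap.range D.rho.toLinearMap from this h
    refine Submodule.span_le.2 ?_
    rintro _ ⟨w, hw, rfl⟩
    obtain ⟨f, n, hn, h⟩ := D.exists_eq_rho_mul w
    rw [hw] at hn
    obtain ⟨f', hf'⟩ := hn.mem_range
    exact ⟨f * f', by simp [h, hf']⟩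
  · rintro ⟨f, rfl⟩
    exact Submodule.subset_span ⟨[.coeff f], by simp [genDeg], by simp; rfl⟩

/-! ### The grading -/

instance : SetLike.GradedMonoid D.homog where
  one_mem := Submodule.subset_span ⟨[], by simp, by simp⟩
  mul_mem g h a b ha hb := by
    have := Submodule.mul_mem_mul ha hb
    rw [homog, homog, Submodule.span_mul_span] at this
    refine Submodule.span_mono ?_ this
    rintro _ ⟨_, ⟨w, hw, rfl⟩, _, ⟨w', hw', rfl⟩, rfl⟩
    exact ⟨w ++ w', by simp [hw, hw'], by simp⟩

lemma gen_mem_homog (z : RTGWGen D) : D.gen z ∈ D.homog (D.genDeg z) :=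
  Submodule.subset_span ⟨[z], by simp, by simp⟩

lemma rho_mem_homog (f : D.L) : D.rho f ∈ D.homog 0 := D.gen_mem_homog (.coeff f)

/-- The degrees with this property form a subgroup that contains every `eᵢ`. Controlling the degree
of the inverse allows division by `u` into degree `0`. -/
lemma exists_homog_unit (g : Fin q → ℤ) :
    ∃ u : D.Algˣ, ↑u ∈ D.homog g ∧ ↑u⁻¹ ∈ D.homog (-g) := by
  let K : AddSubgroup (Fin q → ℤ) :=
    { carrier := {g | ∃ u : D.Algˣ, ↑u ∈ D.homog g ∧ ↑u⁻¹ ∈ D.homog (-g)}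
      zero_mem' := ⟨1, SetLike.GradedOne.one_mem, by
        rw [neg_zero, inv_one]; exact SetLike.GradedOne.one_mem⟩
      add_mem' := by
        rintro g h ⟨u, hu, hu'⟩ ⟨v, hv, hv'⟩
        refine ⟨u * v, SetLike.GradedMul.mul_mem hu hv, ?_⟩
        rw [neg_add_rev, mul_inv_rev]
        exact SetLike.GradedMul.mul_mem hv' hu'
      neg_mem' := by
        rintro g ⟨u, hu, hu'⟩
        exact ⟨u⁻¹, hu', by simpa using hu⟩ }
  suffices g ∈ K from this
  have hx (i : Fin q) : Pi.single i 1 ∈ K := by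
    refine ⟨D.xUnit i, D.gen_mem_homog (.x i), ?_⟩
    have := SetLike.GradedMul.mul_mem (D.rho_mem_homog ↑(D.t i)⁻¹) (D.gen_mem_homog (.y i))
    rwa [zero_add] at this
  rw [← Finset.univ_sum_single g]
  refine sum_mem fun i _ => ?_
  have := K.zsmul_mem (hx i) (g i)
  rwa [← Pi.single_smul, smul_eq_mul, mul_one] at this

lemma iSup_homog : ⨆ g, D.homog g = ⊤ := by
  have h : Algebra.adjoin k (Set.range D.gen) = ⊤ := by
    have : Set.range D.gen = RingQuot.mkAlgHom k D.Rel '' Set.range (FreeAlgebra.ι k) := by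
      rw [← Set.range_comp]; rfl
    rw [this, Algebra.adjoin_image, FreeAlgebra.adjoin_range_ι, Algebra.map_top,
      AlgHom.range_eq_top]
    exact RingQuot.mkAlgHom_surjective k D.Rel
  rw [← Algebra.top_toSubmodule, ← h, Algebra.adjoin_eq_span, eq_comm]
  refine le_antisymm (Submodule.span_le.2 fun a ha => ?_) ?_
  · obtain ⟨l, hl, rfl⟩ := Submonoid.exists_list_of_mem_closure ha
    obtain ⟨w, rfl⟩ : ∃ w : List (RTGWGen D), w.map D.gen = l := by
      have : l ∈ Set.range (List.map D.gen) := by rwa [Set.range_list_map]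
      exact this
    exact Submodule.mem_iSup_of_mem (w.map D.genDeg).sum (Submodule.subset_span ⟨w, rfl, rfl⟩)
  · rw [← Algebra.adjoin_eq_span, h]; exact le_top

/-- Elements of degree `g` move supports by `g`. -/
lemma toModel_apply_add {g : Fin q → ℤ} {a : D.Alg} (ha : a ∈ D.homog g) {m : D.Model}
    {h : Fin q → ℤ} (hm : m h = 0) : D.toModel a m (g + h) = 0 := by
  induction ha using Submodule.span_induction with
  | zero => simp
  | add a b _ _ ha hb => simp [ha, hb]
  | smul c a _ ha => simp [ha]
  | mem a ha =>
    obtain ⟨w, rfl, rfl⟩ := ha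
    induction w with
    | nil => simpa
    | cons z w ih =>
      simp only [List.map_cons, List.sum_cons, List.prod_cons, map_mul, Module.End.mul_apply,
        toModel_gen, add_assoc]
      generalize D.toModel (w.map D.gen).prod m = m' at *
      cases z with
      | coeff f => simp [modelGen, modelCoeff_apply, genDeg, ih]
      | x i => simp [modelGen, modelUnit, modelX_apply, genDeg, ih]
      | y i => simp [modelGen, modelUnit, modelCoeff_apply, modelXInv_apply, genDeg, ih]

/-- The coefficient in degree `g` of an element of `𝔄`, applied to the vector `δ₀`. -/
noncomputable def proj (g : Fin q → ℤ) : D.Alg →ₗ[k] D.L :=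
  LinearMap.proj g ∘ₗ LinearMap.applyₗ (Pi.single 0 1 : D.Model) ∘ₗ D.toModel.toLinearMap

lemma proj_of_ne {g h : Fin q → ℤ} (hgh : g ≠ h) {a : D.Alg} (ha : a ∈ D.homog g) :
    D.proj h a = 0 := by
  have := D.toModel_apply_add ha (m := Pi.single 0 1) (h := -g + h)
    (Pi.single_eq_of_ne (by rwa [Ne, neg_add_eq_zero]) _)
  rwa [add_neg_cancel_left] at this

lemma exists_eq_rho_mul_unit {g : Fin q → ℤ} {a : D.Alg} (ha : a ∈ D.homog g) {u : D.Algˣ}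
    (hu : ↑u⁻¹ ∈ D.homog (-g)) : ∃ f, a = D.rho f * u := by
  have := SetLike.GradedMul.mul_mem ha hu
  rw [add_neg_cancel, mem_homog_zero_iff] at this
  obtain ⟨f, hf⟩ := this
  exact ⟨f, by rw [hf]; simp⟩

lemma exists_eq_unit_mul_rho {g : Fin q → ℤ} {a : D.Alg} (ha : a ∈ D.homog g) {u : D.Algˣ}
    (hu : ↑u⁻¹ ∈ D.homog (-g)) : ∃ f, a = u * D.rho f := by
  have := SetLike.GradedMul.mul_mem hu ha
  rw [neg_add_cancel, mem_homog_zero_iff] at this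
  obtain ⟨f, hf⟩ := this
  exact ⟨f, by rw [hf]; simp⟩

/-- The image of `δ₀` under `a` can be nonzero only at `g`, so here `a` kills `δ₀`. Write `a =
ρ(f)u` with a unit `u`: then `f` annihilates a nonzero value of `u δ₀` in the domain `𝕃`. -/
lemma eq_zero_of_proj {g : Fin q → ℤ} {a : D.Alg} (ha : a ∈ D.homog g) (h : D.proj g a = 0) :
    a = 0 := by
  have h0 : D.toModel a (Pi.single 0 1 : D.Model) = 0 := by
    ext g'
    by_cases hg : g = g'
    · subst hg; exact h
    · exact D.proj_of_ne hg ha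
  obtain ⟨u, -, hu⟩ := D.exists_homog_unit g
  obtain ⟨f, rfl⟩ := D.exists_eq_rho_mul_unit ha hu
  have h1 : D.toModel u (Pi.single 0 1 : D.Model) ≠ 0 := by
    intro h1
    have h2 := congrArg (D.toModel ↑u⁻¹) h1
    rw [← Module.End.mul_apply, ← map_mul, Units.inv_mul, map_one, map_zero] at h2
    have h3 := congrFun h2 0
    simp at h3
  obtain ⟨g', hg'⟩ := Function.ne_iff.1 h1
  have h2 := congrFun h0 g'
  rw [map_mul, Module.End.mul_apply, toModel_rho, modelCoeff_apply, Pi.zero_apply, mul_eq_zero] at h2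
  rw [h2.resolve_right hg', map_zero, zero_mul]

lemma isInternal_homog : DirectSum.IsInternal D.homog := by
  rw [DirectSum.isInternal_submodule_iff_iSupIndep_and_iSup_eq_top]
  refine ⟨?_, D.iSup_homog⟩
  rw [iSupIndep_def]
  intro g
  rw [Submodule.disjoint_def]
  intro a ha ha'
  refine D.eq_zero_of_proj ha ?_
  have : ⨆ h, ⨆ (_ : h ≠ g), D.homog h ≤ LinearMap.ker (D.proj g) :=
    iSup₂_le fun h hh b hb => D.proj_of_ne hh hb
  exact this ha'

lemma isCrossedProduct : IsCrossedProduct D.rho D.homog where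
  gradedMonoid := inferInstance
  isInternal := D.isInternal_homog
  injective := D.rho_injective
  mem_zero_iff := D.mem_homog_zero_iff
  exists_unit g := (D.exists_homog_unit g).imp fun _ h => h.1

end RTGWDatum

/-! ### The Ore condition by counting in boxes -/

open Pointwise in
/-- In `ℤ^q` there are finite sets that hardly grow when a given finite set is added. -/
lemma exists_card_add_lt {q : ℕ} (F : Finset (Fin q → ℤ)) :
    ∃ B : Finset (Fin q → ℤ), (F + B).card < 2 * B.card := by
  let m : ℕ := ∑ f ∈ F, ∑ i, (f i).natAbs
  have hm : ∀ f ∈ F, ∀ i, |f i| ≤ m := fun f hf i => by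
    rw [Int.abs_eq_natAbs]
    exact_mod_cast (Finset.single_le_sum (f := fun i => (f i).natAbs)
      (fun _ _ => Nat.zero_le _) (Finset.mem_univ i)).trans
      (Finset.single_le_sum (f := fun f : Fin q → ℤ => ∑ i, (f i).natAbs)
        (fun _ _ => Nat.zero_le _) hf)
  -- The sum set of `F` and a box of side `N` fits into one of side `N + 2m`. By Bernoulli
  -- `(N/(N+2m))^q ≥ 1 - 2mq/(N+2m)`, which exceeds `1/2` once `N + 2m > 4mq`.
  let N : ℕ := 4 * m * q + 1
  refine ⟨Fintype.piFinset fun _ => Finset.Ico (0 : ℤ) N, ?_⟩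
  have hsub : F + Fintype.piFinset (fun _ => Finset.Ico (0 : ℤ) N) ⊆
      Fintype.piFinset fun _ => Finset.Ico (-m : ℤ) (N + m) := by
    intro x hx
    obtain ⟨f, hf, b, hb, rfl⟩ := Finset.mem_add.1 hx
    refine Fintype.mem_piFinset.2 fun i => ?_
    have h1 := abs_le.1 (hm f hf i)
    have h2 := Finset.mem_Ico.1 (Fintype.mem_piFinset.1 hb i)
    rw [Finset.mem_Ico, Pi.add_apply]
    omega
  have hcard : (F + Fintype.piFinset (fun _ => Finset.Ico (0 : ℤ) N)).card ≤ (N + 2 * m) ^ q := by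
    refine (Finset.card_le_card hsub).trans_eq ?_
    rw [Fintype.card_piFinset_const, Int.card_Ico]
    congr 1
    omega
  refine hcard.trans_lt ?_
  rw [Fintype.card_piFinset_const, Int.card_Ico, sub_zero, Int.toNat_natCast]
  have hpos : (0 : ℚ) < N + 2 * m := by positivity
  have hN : (N : ℚ) = 4 * m * q + 1 := by simp [N]
  have hle : (2 * m : ℚ) / (N + 2 * m) ≤ 1 := by
    rw [div_le_one hpos]; simp
  have hb := one_add_mul_le_pow (a := -((2 * m : ℚ) / (N + 2 * m))) (by linarith) q
  have hq : (q : ℚ) * (2 * m / (N + 2 * m)) < 1 / 2 := by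
    rw [mul_div_assoc', div_lt_iff₀ hpos, hN]
    have : (0 : ℚ) ≤ m := by positivity
    linarith
  have hr : (1 : ℚ) + -((2 * m : ℚ) / (N + 2 * m)) = N / (N + 2 * m) := by
    field_simp; ring
  rw [hr, div_pow] at hb
  have : (1 / 2 : ℚ) < N ^ q / (N + 2 * m) ^ q := by linarith
  rw [lt_div_iff₀ (by positivity)] at this
  have : ((N + 2 * m) ^ q : ℚ) < 2 * N ^ q := by linarith
  exact_mod_cast this

/-- The Ore condition for rings that are spanned over a commutative subring by a family of
elements that is indexed by `ℤ^q` and multiplied as in a crossed product. -/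
lemma exists_mul_eq_mul {R A : Type*} [CommRing R] [Nontrivial R] [Ring A] [NoZeroDivisors A]
    {q : ℕ} (ρ : R →+* A) (u : (Fin q → ℤ) → A)
    (hind : ∀ c : (Fin q → ℤ) →₀ R, (c.sum fun g r => ρ r * u g) = 0 → c = 0)
    (hspan : ∀ a, ∃ F : Finset (Fin q → ℤ), ∀ g, ∃ c : (Fin q → ℤ) → R,
      u g * a = ∑ h ∈ F, ρ (c h) * u (h + g))
    {a b : A} (ha : a ≠ 0) (hb : b ≠ 0) : ∃ c d : A, c * a = d * b ∧ c * a ≠ 0 := by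
  classical
  let _ : Module R A := Module.compHom A ρ
  have smul_def (r : R) (x : A) : r • x = ρ r * x := rfl
  obtain ⟨Fa, hFa⟩ := hspan a
  obtain ⟨Fb, hFb⟩ := hspan b
  obtain ⟨B, hB⟩ := exists_card_add_lt (Fa ∪ Fb)
  let v : B ⊕ B → A := Sum.elim (fun g => u g * a) (fun g => u g * b)
  have hv : ¬ LinearIndependent R v := by
    intro hv
    open Pointwise in
    -- The `2|B|` vectors lie in the span of the `u_h` with `h ∈ (Fa ∪ Fb) + B`, which are too few
    -- for independence over a nontrivial commutative ring.
    have h := linearIndependent_le_span' v hv (((Fa ∪ Fb + B).image u : Finset A) : Set A) ?_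
    · simp only [Cardinal.mk_fintype, Fintype.card_sum, Fintype.card_coe, Nat.cast_le,
        Finset.coe_sort_coe] at h
      have := h.trans Finset.card_image_le
      omega
    · rintro _ ⟨g | g, rfl⟩
      · obtain ⟨c, hc⟩ := hFa g
        simp only [v, Sum.elim_inl, hc]
        refine sum_mem fun h hh => Submodule.smul_mem _ (c h) (Submodule.subset_span ?_)
        exact Finset.mem_coe.2 (Finset.mem_image_of_mem _
          (Finset.add_mem_add (Finset.mem_union_left _ hh) g.2))
      · obtain ⟨c, hc⟩ := hFb g
        simp only [v, Sum.elim_inr, hc]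
        refine sum_mem fun h hh => Submodule.smul_mem _ (c h) (Submodule.subset_span ?_)
        exact Finset.mem_coe.2 (Finset.mem_image_of_mem _
          (Finset.add_mem_add (Finset.mem_union_right _ hh) g.2))
  have hu : LinearIndependent R fun g : B => u g :=
    (linearIndependent_iff.2 fun c hc => hind c hc).comp _ Subtype.val_injective
  rw [Fintype.linearIndependent_iff] at hu
  obtain ⟨c, hc, hc'⟩ := Fintype.not_linearIndependent_iff.1 hv
  rw [Fintype.sum_sum_type] at hc
  simp only [v, Sum.elim_inl, Sum.elim_inr, smul_def, ← mul_assoc, ← Finset.sum_mul] at hc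
  have hcd := eq_neg_of_add_eq_zero_left hc
  rw [← neg_mul] at hcd
  -- If the common multiple vanished, both multipliers would vanish, and independence of the `u_g`
  -- would kill all coefficients of a nontrivial relation.
  refine ⟨_, _, hcd, fun h0 => ?_⟩
  have h1 := (mul_eq_zero.1 h0).resolve_right ha
  have h2 := neg_eq_zero.1 ((mul_eq_zero.1 (hcd.symm.trans h0)).resolve_right hb)
  obtain ⟨g | g, hg⟩ := hc'
  · exact hg (hu _ h1 g)
  · exact hg (hu _ h2 g)

/-! ### `𝔄` is an Ore domain -/

namespace RTGWDatum

variable {k : Type*} [Field k] [Algebra ℝ k] {p q : ℕ} (D : RTGWDatum k p q)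

lemma exists_eq_sum_homog (a : D.Alg) :
    ∃ f : (Fin q → ℤ) →₀ D.Alg, (∀ g, f g ∈ D.homog g) ∧ a = ∑ g ∈ f.support, f g := by
  have : a ∈ ⨆ g, D.homog g := by rw [D.iSup_homog]; trivial
  obtain ⟨f, hf, h⟩ := (Submodule.mem_iSup_iff_exists_finsupp _ _).1 this
  exact ⟨f, hf, h.symm⟩

/-- With `a = u ρ(f)` and `b = ρ(f') v` the units stand outside, and `f f' ≠ 0` in the domain `𝕃`.
-/
lemma homog_mul_ne_zero {g h : Fin q → ℤ} {a b : D.Alg} (ha : a ∈ D.homog g)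
    (hb : b ∈ D.homog h) (ha0 : a ≠ 0) (hb0 : b ≠ 0) : a * b ≠ 0 := by
  intro hab
  obtain ⟨u, hu, hu'⟩ := D.exists_homog_unit g
  obtain ⟨v, hv, hv'⟩ := D.exists_homog_unit h
  obtain ⟨f, rfl⟩ := D.exists_eq_unit_mul_rho ha hu'
  obtain ⟨f', rfl⟩ := D.exists_eq_rho_mul_unit hb hv'
  rw [mul_assoc, Units.mul_right_eq_zero, ← mul_assoc, Units.mul_left_eq_zero, ← map_mul,
    map_eq_zero_iff _ D.rho_injective, mul_eq_zero] at hab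
  rcases hab with rfl | rfl <;> simp at ha0 hb0

instance : NoZeroDivisors D.Alg where
  eq_zero_or_eq_zero_of_mul_eq_zero {a b} hab := by
    obtain ⟨f, hf, hfa⟩ := D.exists_eq_sum_homog a
    obtain ⟨f', hf', hfb⟩ := D.exists_eq_sum_homog b
    rcases f.support.eq_empty_or_nonempty with h | hA
    · left; rw [hfa, h, Finset.sum_empty]
    rcases f'.support.eq_empty_or_nonempty with h | hB
    · right; rw [hfb, h, Finset.sum_empty]
    exfalso
    -- The degree `g + h` arises from a single pair of components, so that component of `ab` is one
    -- product of nonzero homogeneous elements.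
    obtain ⟨g, hg, h, hh, huniq⟩ := UniqueSums.uniqueAdd_of_nonempty hA hB
    refine D.homog_mul_ne_zero (hf g) (hf' h) (Finsupp.mem_support_iff.1 hg)
      (Finsupp.mem_support_iff.1 hh) ?_
    refine D.eq_zero_of_proj (SetLike.GradedMul.mul_mem (hf g) (hf' h)) ?_
    have h0 := congrArg (D.proj (g + h)) hab
    rw [hfa, hfb, Finset.sum_mul_sum, ← Finset.sum_product', map_sum, map_zero,
      Finset.sum_eq_single (g, h)] at h0
    · exact h0
    · rintro ⟨g', h'⟩ hmem hne
      obtain ⟨hg', hh'⟩ := Finset.mem_product.1 hmem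
      refine D.proj_of_ne (fun heq => hne ?_) (SetLike.GradedMul.mul_mem (hf g') (hf' h'))
      obtain ⟨h1, h2⟩ := huniq hg' hh' heq
      exact Prod.ext h1 h2
    · exact fun hn => (hn (Finset.mem_product.2 ⟨hg, hh⟩)).elim

lemma sum_homog_eq_zero {s : Finset (Fin q → ℤ)} {f : (Fin q → ℤ) → D.Alg}
    (hf : ∀ g, f g ∈ D.homog g) (h : ∑ g ∈ s, f g = 0) {g : Fin q → ℤ} (hg : g ∈ s) :
    f g = 0 := by
  refine D.eq_zero_of_proj (hf g) ?_
  have h0 := congrArg (D.proj g) h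
  rwa [map_sum, map_zero, Finset.sum_eq_single g (fun g' _ hne => D.proj_of_ne hne (hf g'))
    (fun hn => (hn hg).elim)] at h0

lemma rho_mul_mem_homog (f : D.L) {g : Fin q → ℤ} {a : D.Alg} (ha : a ∈ D.homog g) :
    D.rho f * a ∈ D.homog g := by
  simpa using SetLike.GradedMul.mul_mem (D.rho_mem_homog f) ha

lemma mul_rho_mem_homog (f : D.L) {g : Fin q → ℤ} {a : D.Alg} (ha : a ∈ D.homog g) :
    a * D.rho f ∈ D.homog g := by
  simpa using SetLike.GradedMul.mul_mem ha (D.rho_mem_homog f)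

lemma left_ore {a b : D.Alg} (ha : a ≠ 0) (hb : b ≠ 0) :
    ∃ c d : D.Alg, c * a = d * b ∧ c * a ≠ 0 := by
  choose u hu hu' using D.exists_homog_unit
  refine exists_mul_eq_mul (D.rho : D.L →+* D.Alg) (fun g => (u g : D.Alg)) ?_ ?_ ha hb
  · intro c hc
    ext g
    by_contra hg
    have := D.sum_homog_eq_zero (fun g => D.rho_mul_mem_homog (c g) (hu g)) hc
      (Finsupp.mem_support_iff.2 hg)
    rw [Units.mul_left_eq_zero, map_eq_zero_iff _ D.rho_injective] at this
    exact hg this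
  · intro a
    obtain ⟨f, hf, rfl⟩ := D.exists_eq_sum_homog a
    refine ⟨f.support, fun g => ?_⟩
    have (h : Fin q → ℤ) : ∃ r, u g * f h = D.rho r * u (h + g) :=
      D.exists_eq_rho_mul_unit (add_comm g h ▸ SetLike.GradedMul.mul_mem (hu g) (hf h)) (hu' _)
    choose c hc using this
    exact ⟨c, by rw [Finset.mul_sum]; exact Finset.sum_congr rfl fun h _ => hc h⟩

/-- The same count in the opposite ring: `𝕃` is commutative, so `rho` also maps into it, and
coefficients are now collected on the right. -/
lemma right_ore {a b : D.Alg} (ha : a ≠ 0) (hb : b ≠ 0) :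
    ∃ c d : D.Alg, a * c = b * d ∧ a * c ≠ 0 := by
  choose u hu hu' using D.exists_homog_unit
  suffices H : ∃ c d : D.Algᵐᵒᵖ, c * .op a = d * .op b ∧ c * .op a ≠ 0 by
    obtain ⟨c, d, h, h0⟩ := H
    exact ⟨c.unop, d.unop, congrArg MulOpposite.unop h,
      fun h1 => h0 (MulOpposite.unop_injective h1)⟩
  refine exists_mul_eq_mul
    ((D.rho : D.L →+* D.Alg).toOpposite fun f g => by
      rw [Commute, SemiconjBy, ← map_mul, ← map_mul, mul_comm])
    (fun g => MulOpposite.op (u g : D.Alg)) ?_ ?_ ((MulOpposite.op_ne_zero_iff a).2 ha)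
    ((MulOpposite.op_ne_zero_iff b).2 hb)
  · intro c hc
    ext g
    by_contra hg
    have hc := congrArg MulOpposite.unop hc
    rw [Finsupp.sum, Finset.unop_sum] at hc
    have := D.sum_homog_eq_zero (fun g => D.mul_rho_mem_homog (c g) (hu g)) hc
      (Finsupp.mem_support_iff.2 hg)
    rw [Units.mul_right_eq_zero, map_eq_zero_iff _ D.rho_injective] at this
    exact hg this
  · intro a
    obtain ⟨f, hf, ha⟩ := D.exists_eq_sum_homog a.unop
    refine ⟨f.support, fun g => ?_⟩
    have (h : Fin q → ℤ) : ∃ r, f h * u g = u (h + g) * D.rho r :=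
      D.exists_eq_unit_mul_rho (SetLike.GradedMul.mul_mem (hf h) (hu g)) (hu' _)
    choose c hc using this
    refine ⟨c, MulOpposite.unop_injective ?_⟩
    rw [MulOpposite.unop_mul, ha, Finset.unop_sum, MulOpposite.unop_op, Finset.sum_mul]
    exact Finset.sum_congr rfl fun h _ => hc h

lemma isOreDomain : IsOreDomain D.Alg where
  isDomain :=
    haveI : Nontrivial D.Alg := D.rho_injective.nontrivial
    NoZeroDivisors.to_isDomain _
  left_ore _ _ ha hb := D.left_ore ha hb
  right_ore _ _ ha hb := D.right_ore ha hb

end RTGWDatum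

theorem mainTheorem3 {k : Type*} [Field k] [Algebra ℝ k] {p q : ℕ} (D : RTGWDatum k p q) :
    IsCrossedProduct D.rho D.homog ∧ IsOreDomain D.Alg :=
  ⟨D.isCrossedProduct, D.isOreDomain⟩
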